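/- Call a string of length $n$ non-repetitive if no character occurs twice in it. For two non-repetitive strings $A,B$ of length $n$ over a finite alphabet $\Sigma$ with $|\Sigma|\ge n$, let the Ulam distance $\mathrm{ud}(A,B)$ be the minimum number of character additions and character deletions (each of unit cost) that transform $A$ into $B$. For $\epsilon\in[0,1)$, a real number $r$ is a $(1+\epsilon)$-approximation of $\mathrm{ud}(A,B)$ if $(1-\epsilon)\,\mathrm{ud}(A,B)\le r\le(1+\epsilon)\,\mathrm{ud}(A,B)$. A quantum algorithm accesses $A$ and $B$ through the oracles $O_X\colon |i\rangle|a\rangle|z\rangle\mapsto|i\rangle|a\oplus X[i]\rangle|z\rangle$, $X\in\{A,B\}$, where $i\in\{1,\dots,n\}$, $a$ is the content of a character register, $z$ is the content of the work memory, and $\oplus$ is a fixed operation such that $a\mapsto a\oplus s$ is a permutation for every $s\in\Sigma$ (e.g. bitwise parity of binary encodings). It starts in a fixed basis state, performs a fixed sequence of steps, each of which is a unitary gate (from an arbitrary gate set) or a call to $O_A$ or $O_B$, and finally measures in the computational basis and outputs a real number computed from the result. Its running time is its number of steps. It computes a $(1+\epsilon)$-approximation of the Ulam distance with high probability if, for all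 non-repetitive strings $A,B\in\Sigma^n$, its output is a $(1+\epsilon)$-approximation of $\mathrm{ud}(A,B)$ with probability at least $9/10$. **Theorem.** For any $\epsilon\in[0,1)$, any quantum algorithm that computes with high probability a $(1+\epsilon)$-approximation of the Ulam distance of two non-repetitive strings of length $n$ requires $\Omega(\sqrt n)$ time. That is, there is a constant $c>0$ such that for every $n\ge 2$, every finite alphabet $\Sigma$ with $|\Sigma|\ge n$, and every choice of character register, operation $\oplus$, work memory and gate set, every such algorithm has running time at least $c\sqrt n$. -/

import Mathlib

namespace UlamLB

/-! ### Ulam distance -/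

/-- One edit operation on strings: insertion or deletion of a single character. -/
inductive EditStep {α : Type*} : List α → List α → Prop
  | add (u v : List α) (a : α) : EditStep (u ++ v) (u ++ a :: v)
  | del (u v : List α) (a : α) : EditStep (u ++ a :: v) (u ++ v)

/-- `EditPath k x y`: the string `x` can be transformed into `y` by exactly `k` operations. -/
inductive EditPath {α : Type*} : ℕ → List α → List α → Prop
  | refl (x : List α) : EditPath 0 x x
  | head {k : ℕ} {x y z : List α} : EditStep x y → EditPath k y z → EditPath (k + 1) x z

/-- Some sequence of operations always exists, so the minimum in `ulamDist` is over a
nonempty set. -/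
theorem exists_editPath {α : Type*} (x y : List α) : ∃ k, EditPath k x y := by
  induction x with
  | nil =>
    suffices h : ∀ u v : List α, ∃ k, EditPath k u (u ++ v) from h [] y
    intro u v
    induction v generalizing u with
    | nil => exact ⟨0, by simpa using EditPath.refl u⟩
    | cons a v ih =>
      obtain ⟨k, hk⟩ := ih (u ++ [a])
      refine ⟨k + 1, EditPath.head (y := u ++ [a]) ?_ (by simpa using hk)⟩
      simpa using EditStep.add u [] a
  | cons a x ih =>
    obtain ⟨k, hk⟩ := ih
    exact ⟨k + 1, EditPath.head (EditStep.del [] x a) hk⟩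

/-- The minimum number of character additions and deletions that transform the string `A`
into the string `B`. It is called the Ulam distance when `A` and `B` are non-repetitive, i.e.
injective. -/
noncomputable def ulamDist {α : Type*} {n : ℕ} (A B : Fin n → α) : ℕ :=
  sInf {k | EditPath k (List.ofFn A) (List.ofFn B)}

/-- The output `r` is a `(1 + ε)`-approximation of the Ulam distance of `A` and `B`. -/
def IsApprox {α : Type*} {n : ℕ} (ε : ℝ) (A B : Fin n → α) (r : ℝ) : Prop :=
  (1 - ε) * (ulamDist A B : ℝ) ≤ r ∧ r ≤ (1 + ε) * (ulamDist A B : ℝ)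

/-! ### Quantum algorithms with oracle access to two strings -/

/-- Computational basis states `|i⟩|r⟩|z⟩`: a position `i` of the strings, the content `r` of a
character register and the content `z` of the remaining (work) memory. -/
abbrev Basis (n : ℕ) (R W : Type*) : Type _ := Fin n × R × W

/-- The Hilbert space spanned by the basis states. -/
abbrev State (n : ℕ) (R W : Type*) : Type _ := EuclideanSpace ℂ (Basis n R W)

/-- Unitary operators on the Hilbert space. -/
abbrev UnitaryOp (n : ℕ) (R W : Type*) [Fintype R] [Fintype W] : Type _ :=
  State n R W ≃ₗᵢ[ℂ] State n R W

/-- The permutation `(i, r, z) ↦ (i, r ⊕ X[i], z)` of the basis states, where `r ⊕ a` is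
`shift a r`. -/
def oraclePerm {n : ℕ} {α R W : Type*} (shift : α → Equiv.Perm R) (X : Fin n → α) :
    Equiv.Perm (Basis n R W) where
  toFun b := (b.1, shift (X b.1) b.2.1, b.2.2)
  invFun b := (b.1, (shift (X b.1)).symm b.2.1, b.2.2)
  left_inv b := by simp
  right_inv b := by simp

/-- The oracle `O_X : |i⟩|r⟩|z⟩ ↦ |i⟩|r ⊕ X[i]⟩|z⟩` for the string `X`. -/
noncomputable def oracle {n : ℕ} {α R W : Type*} [Fintype R] [Fintype W]
    (shift : α → Equiv.Perm R) (X : Fin n → α) : UnitaryOp n R W :=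
  LinearIsometryEquiv.piLpCongrLeft 2 ℂ ℂ (oraclePerm shift X)

/-- The oracle acts on basis states as announced. -/
theorem oracle_single {n : ℕ} {α R W : Type*} [Fintype R] [Fintype W] [DecidableEq R]
    [DecidableEq W] (shift : α → Equiv.Perm R) (X : Fin n → α) (i : Fin n) (r : R) (z : W) :
    oracle shift X (EuclideanSpace.single ((i, r, z) : Basis n R W) (1 : ℂ)) =
      EuclideanSpace.single ((i, shift (X i) r, z) : Basis n R W) (1 : ℂ) :=
  LinearIsometryEquiv.piLpCongrLeft_single (oraclePerm shift X) _ _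

/-- One time step of a quantum algorithm: an elementary gate, taken from the gate set `G`, or a
call to one of the oracles `O_A` and `O_B`. -/
inductive QStep (n : ℕ) (R W : Type*) [Fintype R] [Fintype W] (G : Set (UnitaryOp n R W))
  | gate (U : UnitaryOp n R W) (hU : U ∈ G)
  | queryA
  | queryB

/-- The unitary operator performed by a step when the input is `(A, B)`. -/
noncomputable def QStep.op {n : ℕ} {R W : Type*} [Fintype R] [Fintype W]
    {G : Set (UnitaryOp n R W)} {α : Type*} (shift : α → Equiv.Perm R) (A B : Fin n → α) :
    QStep n R W G → UnitaryOp n R W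
  | .gate U _ => U
  | .queryA => oracle shift A
  | .queryB => oracle shift B

/-- A quantum algorithm (for strings of length `n`): it starts in a fixed basis state, performs a
fixed sequence of steps, then measures in the computational basis and outputs a real number
computed from the measured basis state. -/
structure QAlgorithm (n : ℕ) (R W : Type*) [Fintype R] [Fintype W]
    (G : Set (UnitaryOp n R W)) where
  init : Basis n R W
  steps : List (QStep n R W G)
  output : Basis n R W → ℝ

namespace QAlgorithm

variable {n : ℕ} {R W : Type*} [Fintype R] [Fintype W] {G : Set (UnitaryOp n R W)} {α : Type*}

/-- The running time: every gate and every oracle call takes one unit of time. -/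
def time (Q : QAlgorithm n R W G) : ℕ := Q.steps.length

open Classical in
/-- The state before the measurement, on input `(A, B)`. -/
noncomputable def finalState (Q : QAlgorithm n R W G) (shift : α → Equiv.Perm R)
    (A B : Fin n → α) : State n R W :=
  Q.steps.foldl (fun ψ s => s.op shift A B ψ) (EuclideanSpace.single Q.init 1)

open Classical in
/-- The probability that the output satisfies `P`, on input `(A, B)` (Born rule). -/
noncomputable def prob (Q : QAlgorithm n R W G) (shift : α → Equiv.Perm R)
    (A B : Fin n → α) (P : ℝ → Prop) : ℝ :=
  ∑ b : Basis n R W, if P (Q.output b) then ‖Q.finalState shift A B b‖ ^ 2 else 0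

/-- With high probability, i.e. with probability at least `9 / 10`, the algorithm outputs a
`(1 + ε)`-approximation of the Ulam distance, for all non-repetitive strings `A` and `B` of
length `n` over the alphabet `α`. -/
def ApproximatesUlam (Q : QAlgorithm n R W G) (shift : α → Equiv.Perm R) (ε : ℝ) : Prop :=
  ∀ A B : Fin n → α, Function.Injective A → Function.Injective B →
    9 / 10 ≤ Q.prob shift A B (IsApprox ε A B)

end QAlgorithm

end UlamLB

namespace UlamLB

/-! ### Ulam distance zero -/

/-! A multiplicative approximation must separate distance zero from positive distance, so the
algorithm must tell `(A, A)` from each of the `n` inputs `(A, A ∘ swap j (f j))`, where `f` is a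
permutation without fixed points. Swapping keeps the string non-repetitive. Hybrid argument: collect
the `n` differences of states in one `ℓ²` vector. A query to the second string changes the `j`-th
difference only through the weight at `j` and `f j`; summed over `j` these weights are at most 2, so
the vector grows by at most 3 per step (`norm_step_sub_le`, `norm_foldl_sub_le`). At the end each
difference has norm at least 1/2 (`quarter_le_norm_finalState_sub_sq`), so `√n / 2 ≤ 3 T` for
running time `T`. -/

theorem ulamDist_self {α : Type*} {n : ℕ} (A : Fin n → α) : ulamDist A A = 0 :=
  Nat.sInf_eq_zero.2 (Or.inl (EditPath.refl _))

theorem ulamDist_pos {α : Type*} {n : ℕ} {A B : Fin n → α} (h : A ≠ B) : 0 < ulamDist A B := by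
  rw [Nat.pos_iff_ne_zero]
  intro h0
  rcases Nat.sInf_eq_zero.1 h0 with h1 | h1
  · refine h (List.ofFn_injective ?_)
    generalize List.ofFn A = x at h1
    generalize List.ofFn B = y at h1
    cases h1
    rfl
  -- The infimum of the empty set is 0 by convention; this case cannot occur.
  · obtain ⟨k, hk⟩ := exists_editPath (List.ofFn A) (List.ofFn B)
    exact (h1 ▸ hk : k ∈ (∅ : Set ℕ))

theorem IsApprox.eq_zero {α : Type*} {n : ℕ} {ε r : ℝ} {A : Fin n → α}
    (h : IsApprox ε A A r) : r = 0 := by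
  obtain ⟨h1, h2⟩ := h
  rw [ulamDist_self] at h1 h2
  norm_num at h1 h2
  exact le_antisymm h2 h1

theorem IsApprox.pos {α : Type*} {n : ℕ} {ε r : ℝ} {A B : Fin n → α} (hε : ε < 1)
    (hAB : A ≠ B) (h : IsApprox ε A B r) : 0 < r := by
  have hd : (0 : ℝ) < ulamDist A B := by exact_mod_cast ulamDist_pos hAB
  exact (mul_pos (sub_pos.2 hε) hd).trans_le h.1

/-! ### Distinguishing two states by a measurement -/

theorem norm_sq_le_two_mul {E : Type*} [SeminormedAddCommGroup E] (x y : E) :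
    ‖x‖ ^ 2 ≤ 2 * (‖y‖ ^ 2 + ‖x - y‖ ^ 2) := by
  have h : ‖x‖ ≤ ‖y‖ + ‖x - y‖ := by
    simpa using norm_add_le y (x - y)
  nlinarith [norm_nonneg x, norm_nonneg y, norm_nonneg (x - y), sq_nonneg (‖y‖ - ‖x - y‖)]

/-- Unit vectors which a measurement in the standard basis tells apart with error `1 / 10`
have distance at least `1 / 2`. -/
theorem quarter_le_norm_sub_sq {ι : Type*} [Fintype ι] (s t : Finset ι) (hst : Disjoint s t)
    (ψ φ : EuclideanSpace ℂ ι) (hφ : ‖φ‖ = 1) (hs : 9 / 10 ≤ ∑ b ∈ s, ‖ψ b‖ ^ 2)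
    (ht : 9 / 10 ≤ ∑ b ∈ t, ‖φ b‖ ^ 2) : 1 / 4 ≤ ‖ψ - φ‖ ^ 2 := by
  classical
  have h1 : ∑ b ∈ s, ‖φ b‖ ^ 2 + ∑ b ∈ t, ‖φ b‖ ^ 2 ≤ 1 := by
    rw [← Finset.sum_union hst]
    calc _ ≤ ∑ b, ‖φ b‖ ^ 2 :=
          Finset.sum_le_sum_of_subset_of_nonneg (Finset.subset_univ _) fun _ _ _ => sq_nonneg _
      _ = 1 := by rw [← EuclideanSpace.norm_sq_eq, hφ, one_pow]
  have h2 : ∑ b ∈ s, ‖ψ b - φ b‖ ^ 2 ≤ ‖ψ - φ‖ ^ 2 := by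
    rw [EuclideanSpace.norm_sq_eq]
    exact Finset.sum_le_sum_of_subset_of_nonneg (Finset.subset_univ _) fun _ _ _ => sq_nonneg _
  have h3 : ∑ b ∈ s, ‖ψ b‖ ^ 2 ≤ 2 * (∑ b ∈ s, ‖φ b‖ ^ 2 + ∑ b ∈ s, ‖ψ b - φ b‖ ^ 2) := by
    rw [← Finset.sum_add_distrib, Finset.mul_sum]
    exact Finset.sum_le_sum fun b _ => norm_sq_le_two_mul _ _
  -- Since `φ` has mass at most 1/10 on `s`, the squared distance is at least 9/20 - 1/10 = 7/20.
  linarith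

/-! ### Effect of an oracle call -/

section Oracle

variable {n : ℕ} {α R W : Type*} [Fintype R] [Fintype W]

/-- The probability that the position register of `ψ` holds `i`. -/
noncomputable def posWeight (ψ : State n R W) (i : Fin n) : ℝ :=
  ∑ p : R × W, ‖ψ (i, p)‖ ^ 2

theorem posWeight_nonneg (ψ : State n R W) (i : Fin n) : 0 ≤ posWeight ψ i :=
  Finset.sum_nonneg fun _ _ => sq_nonneg _

theorem sum_posWeight (ψ : State n R W) : ∑ i, posWeight ψ i = ‖ψ‖ ^ 2 := by
  rw [EuclideanSpace.norm_sq_eq, Fintype.sum_prod_type]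
  rfl

theorem oracle_apply (shift : α → Equiv.Perm R) (X : Fin n → α) (ψ : State n R W)
    (i : Fin n) (r : R) (z : W) :
    oracle shift X ψ (i, r, z) = ψ (i, (shift (X i)).symm r, z) := rfl

/-- For a fixed position the oracle only permutes the register contents. -/
theorem posWeight_oracle (shift : α → Equiv.Perm R) (X : Fin n → α) (ψ : State n R W)
    (i : Fin n) : posWeight (oracle shift X ψ) i = posWeight ψ i :=
  Fintype.sum_equiv ((shift (X i)).symm.prodCongr (Equiv.refl W)) _ _ fun _ => rfl

theorem posWeight_sub_le (ψ φ : State n R W) (i : Fin n) :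
    posWeight (ψ - φ) i ≤ 2 * (posWeight ψ i + posWeight φ i) := by
  unfold posWeight
  rw [← Finset.sum_add_distrib, Finset.mul_sum]
  refine Finset.sum_le_sum fun p _ => ?_
  have h := norm_sq_le_two_mul (ψ (i, p) - φ (i, p)) (ψ (i, p))
  rw [sub_sub_cancel_left, norm_neg] at h
  exact h

/-- Oracle calls for strings that differ in at most the positions `i` and `k` differ by at most
the weight of these positions, up to a constant. -/
theorem norm_oracle_sub_oracle_sq_le (shift : α → Equiv.Perm R) (X Y : Fin n → α) (i k : Fin n)
    (hXY : ∀ l, l ≠ i → l ≠ k → X l = Y l) (ψ : State n R W) :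
    ‖oracle shift X ψ - oracle shift Y ψ‖ ^ 2 ≤ 4 * (posWeight ψ i + posWeight ψ k) := by
  classical
  have hw : ∀ l, posWeight (oracle shift X ψ - oracle shift Y ψ) l ≤ 4 * posWeight ψ l := by
    intro l
    have h := posWeight_sub_le (oracle shift X ψ) (oracle shift Y ψ) l
    rw [posWeight_oracle, posWeight_oracle] at h
    linarith
  have h0 : ∀ l, l ≠ i → l ≠ k → posWeight (oracle shift X ψ - oracle shift Y ψ) l = 0 := by
    intro l hi hk
    refine Finset.sum_eq_zero fun p _ => ?_
    rw [PiLp.sub_apply, oracle_apply, oracle_apply, hXY l hi hk, sub_self]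
    simp
  rw [← sum_posWeight]
  -- Two separate indicators also cover the case `i = k`, where the weight is counted twice.
  calc _ ≤ ∑ l, ((if l = i then 4 * posWeight ψ l else 0) +
        if l = k then 4 * posWeight ψ l else 0) := by
        refine Finset.sum_le_sum fun l _ => ?_
        have := hw l
        have := posWeight_nonneg ψ l
        split_ifs with hi hk hk
        · linarith
        · linarith
        · linarith
        · rw [h0 l hi hk, add_zero]
    _ = _ := by
        rw [Finset.sum_add_distrib, Finset.sum_ite_eq', Finset.sum_ite_eq', mul_add]
        simp

end Oracle

/-! ### The hybrid argument -/

section Hybrid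

variable {n : ℕ} {α R W : Type*} [Fintype R] [Fintype W] {G : Set (UnitaryOp n R W)}

/-- In one step, the joint distance in `ℓ²` between the run on `(A, A)` and the runs on
`(A, A ∘ swap j (f j))` grows by at most a constant, where `f` is a permutation. -/
theorem norm_step_sub_le (shift : α → Equiv.Perm R) (A : Fin n → α) (f : Equiv.Perm (Fin n))
    (s : QStep n R W G) (ψ : State n R W) (hψ : ‖ψ‖ ≤ 1) :
    ‖WithLp.toLp 2 fun j => s.op shift A A ψ - s.op shift A (A ∘ Equiv.swap j (f j)) ψ‖ ≤ 3 := by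
  refine le_of_sq_le_sq ?_ (by norm_num)
  rw [PiLp.norm_sq_eq_of_L2]
  cases s with
  | gate U hU => simp [QStep.op]
  | queryA => simp [QStep.op]
  | queryB =>
    calc _ ≤ ∑ j, 4 * (posWeight ψ j + posWeight ψ (f j)) := by
          refine Finset.sum_le_sum fun j _ =>
            norm_oracle_sub_oracle_sq_le shift A _ j (f j) (fun l h1 h2 => ?_) ψ
          rw [Function.comp_apply, Equiv.swap_apply_of_ne_of_ne h1 h2]
      -- As `f` is a bijection, each position is counted exactly twice.
      _ = 8 * ‖ψ‖ ^ 2 := by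
          rw [← Finset.mul_sum, Finset.sum_add_distrib, Equiv.sum_comp f (posWeight ψ),
            sum_posWeight]
          ring
      _ ≤ 3 ^ 2 := by nlinarith [norm_nonneg ψ]

/-- Unitarity preserves the differences accumulated so far, so each step adds only the error it
makes on the common run on `(A, A)`. -/
theorem norm_foldl_sub_le (shift : α → Equiv.Perm R) (A : Fin n → α) (f : Equiv.Perm (Fin n))
    (L : List (QStep n R W G)) (ψ : State n R W) (hψ : ‖ψ‖ ≤ 1) (φ : Fin n → State n R W) :
    ‖WithLp.toLp 2 fun j => L.foldl (fun χ s => s.op shift A A χ) ψ -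
        L.foldl (fun χ s => s.op shift A (A ∘ Equiv.swap j (f j)) χ) (φ j)‖ ≤
      ‖WithLp.toLp 2 fun j => ψ - φ j‖ + 3 * L.length := by
  induction L generalizing ψ φ with
  | nil => simp
  | cons s L ih =>
    have h1 := ih (s.op shift A A ψ) (by rwa [LinearIsometryEquiv.norm_map])
      fun j => s.op shift A (A ∘ Equiv.swap j (f j)) (φ j)
    have h2 : ‖WithLp.toLp 2 fun j =>
          s.op shift A A ψ - s.op shift A (A ∘ Equiv.swap j (f j)) (φ j)‖ ≤
        3 + ‖WithLp.toLp 2 fun j => ψ - φ j‖ := by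
      have h3 : ‖WithLp.toLp 2 fun j => s.op shift A (A ∘ Equiv.swap j (f j)) (ψ - φ j)‖ =
          ‖WithLp.toLp 2 fun j => ψ - φ j‖ := by
        simp only [PiLp.norm_eq_of_L2, LinearIsometryEquiv.norm_map]
      rw [← h3]
      -- With `U`, `V j` the step on the two inputs, `U ψ - V j (φ j) = (U ψ - V j ψ) + V j (ψ - φ
      -- j)`.
      refine le_trans (le_of_eq ?_) ((norm_add_le _ _).trans
        (add_le_add_left (norm_step_sub_le shift A f s ψ hψ) _))
      rw [← WithLp.toLp_add]
      congr 2
      funext j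
      rw [Pi.add_apply, map_sub, sub_add_sub_cancel]
    simp only [List.foldl_cons, List.length_cons, Nat.cast_add, Nat.cast_one]
    linarith

theorem norm_finalState (Q : QAlgorithm n R W G) (shift : α → Equiv.Perm R) (A B : Fin n → α) :
    ‖Q.finalState shift A B‖ = 1 := by
  classical
  have h : ∀ (L : List (QStep n R W G)) (ψ : State n R W),
      ‖L.foldl (fun χ s => s.op shift A B χ) ψ‖ = ‖ψ‖ := by
    intro L
    induction L with
    | nil => exact fun _ => rfl
    | cons s L ih => exact fun ψ => (ih _).trans (LinearIsometryEquiv.norm_map _ _)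
  rw [QAlgorithm.finalState, h]
  simp

/-- A correct output is exactly 0 on `(A, A)` and positive on `(A, B)`, so the two success events
are disjoint. -/
theorem quarter_le_norm_finalState_sub_sq {Q : QAlgorithm n R W G} {shift : α → Equiv.Perm R}
    {ε : ℝ} (hε : ε < 1) (hQ : Q.ApproximatesUlam shift ε) {A B : Fin n → α}
    (hA : Function.Injective A) (hB : Function.Injective B) (hAB : A ≠ B) :
    1 / 4 ≤ ‖Q.finalState shift A A - Q.finalState shift A B‖ ^ 2 := by
  classical
  have h1 := hQ A A hA hA
  have h2 := hQ A B hA hB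
  rw [QAlgorithm.prob, ← Finset.sum_filter] at h1 h2
  refine quarter_le_norm_sub_sq _ _ ?_ _ _ (norm_finalState Q shift A B) h1 h2
  rw [Finset.disjoint_filter]
  intro b _ h3 h4
  exact (h4.pos hε hAB).ne' h3.eq_zero

theorem sqrt_le_six_mul_time {Q : QAlgorithm n R W G} {shift : α → Equiv.Perm R} {ε : ℝ}
    (hε : ε < 1) (hQ : Q.ApproximatesUlam shift ε) {A : Fin n → α} (hA : Function.Injective A)
    (f : Equiv.Perm (Fin n)) (hf : ∀ j, f j ≠ j) : Real.sqrt n ≤ 6 * Q.time := by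
  classical
  have h1 := norm_foldl_sub_le shift A f Q.steps (EuclideanSpace.single Q.init 1) (by simp)
    fun _ => EuclideanSpace.single Q.init 1
  have h2 : (n : ℝ) * (1 / 4) ≤ ‖WithLp.toLp 2 fun j => Q.finalState shift A A -
      Q.finalState shift A (A ∘ Equiv.swap j (f j))‖ ^ 2 := by
    rw [PiLp.norm_sq_eq_of_L2]
    calc (n : ℝ) * (1 / 4) = ∑ _j : Fin n, (1 / 4 : ℝ) := by simp
      _ ≤ _ := Finset.sum_le_sum fun j _ => by
        refine quarter_le_norm_finalState_sub_sq hε hQ hA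
          (hA.comp (Equiv.injective _)) fun h => hf j ?_
        have := congrFun h j
        rw [Function.comp_apply, Equiv.swap_apply_left] at this
        exact (hA this).symm
  have h3 : ‖WithLp.toLp 2 fun j => Q.finalState shift A A -
      Q.finalState shift A (A ∘ Equiv.swap j (f j))‖ ≤ 3 * Q.time := by
    refine le_trans (le_of_eq ?_) (h1.trans (le_of_eq ?_))
    · simp only [QAlgorithm.finalState]
    -- All runs share the initial state, so the initial distance vanishes.
    · simp [PiLp.norm_eq_of_L2, QAlgorithm.time]
  refine Real.sqrt_le_iff.2 ⟨by positivity, ?_⟩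
  have h4 := pow_le_pow_left₀ (norm_nonneg _) h3 2
  nlinarith

end Hybrid

end UlamLB

/-- For every `ε ∈ [0, 1)` there is `c > 0` such that for all `n ≥ 2`, over every finite alphabet
that admits non-repetitive strings of length `n`, for every character register `R` with an
operation `r ⊕ a = shift a r`, every work memory `W` and every gate set `G`, each quantum algorithm
that computes with high probability a `(1 + ε)`-approximation of the Ulam distance takes time at
least `c √n`. -/
theorem theorem10 (ε : ℝ) (hε0 : 0 ≤ ε) (hε1 : ε < 1) :
    ∃ c : ℝ, 0 < c ∧
      ∀ n : ℕ, 2 ≤ n →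
      ∀ (α : Type*) [Fintype α], n ≤ Fintype.card α →
      ∀ (R W : Type*) [Fintype R] [Fintype W] (shift : α → Equiv.Perm R)
        (G : Set (UlamLB.UnitaryOp n R W)) (Q : UlamLB.QAlgorithm n R W G),
        Q.ApproximatesUlam shift ε →
        c * Real.sqrt (n : ℝ) ≤ (Q.time : ℝ) := by
  refine ⟨1 / 6, by norm_num, fun n hn α _ hα R W _ _ shift G Q hQ => ?_⟩
  obtain ⟨A⟩ : Nonempty (Fin n ↪ α) :=
    Function.Embedding.nonempty_of_card_le (by simpa using hα)
  -- The cyclic shift has no fixed point because `n ≥ 2`.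
  have hf : ∀ j : Fin n, finRotate n j ≠ j := by
    obtain ⟨m, rfl⟩ := Nat.exists_eq_add_of_le' hn
    intro j
    rw [finRotate_apply]
    simp
  have h := UlamLB.sqrt_le_six_mul_time hε1 hQ A.injective (finRotate n) hf
  linarith
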